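/- Let $R$ be a discrete valuation ring with field of fractions $F=\operatorname{Frac}(R)$, maximal ideal $\mathfrak m_R$ and formal completion $\hat R=\varprojlim_n R/\mathfrak m_R^n$, and let $p\ge 1$ be the characteristic exponent of $F$ (so $p=1$ if $\operatorname{char}F=0$, and $p=\operatorname{char}F$ otherwise). The $p$-radical closure of $R$ is the subring $$R^{\mathrm{prc}}=\{\,b\in\hat R \mid b^{p^\nu}\in R\text{ for some }\nu\ge 0\,\}\subset\hat R .$$ Let $A_\lambda$, $\lambda\in L$, be the family of all $R$-subalgebras $A_\lambda\subset R^{\mathrm{prc}}$ that are finitely generated as $R$-modules, and put $n_\lambda=\operatorname{rank}_R(A_\lambda)$. A local ring is called excellent if it is noetherian, universally catenary, and has geometrically regular formal fibers. Suppose that there is an intermediate field $F\subset F'\subset\operatorname{Frac}(\hat R)$ such that $F\subset F'$ is purely inseparable and the (not necessarily algebraic) extension $F'\subset\operatorname{Frac}(\hat R)$ is separable, that is, $\operatorname{Frac}(\hat R)\otimes_{F'}K$ is reduced for every field extension $F'\subset K$. Then the following hold. 1. $R^{\mathrm{prc}}$ is an excellent discrete valuation ring. 2. The extension of local rings $R\subset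 R^{\mathrm{prc}}$ has ramification index $e=\operatorname{length}_{R^{\mathrm{prc}}}(R^{\mathrm{prc}}/\mathfrak m_RR^{\mathrm{prc}})=1$, residual degree $f=[\kappa(R^{\mathrm{prc}}):\kappa(R)]=1$, and degree $n=[R^{\mathrm{prc}}\otimes_RF:F]=\sup_{\lambda\in L}n_\lambda$, as elements of $\{0,1,2,\ldots\}\cup\{\infty\}$. 3. The induced map on formal completions $\hat R\to\widehat{R^{\mathrm{prc}}}$ is bijective. 4. If $R$ is not excellent, then the ring extension $R\subset R^{\mathrm{prc}}$ is integral but not finite. -/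

import Mathlib

open IsLocalRing TensorProduct

noncomputable section

namespace PRC

universe u v

/-! ### Formal completions -/

/-- The formal completion `R̂ = lim R / 𝔪ⁿ` of a local ring. -/
abbrev Completion (R : Type u) [CommRing R] [IsLocalRing R] : Type u :=
  AdicCompletion (maximalIdeal R) R

theorem algebraMap_completion_injective (R : Type u) [CommRing R] [IsLocalRing R]
    [IsNoetherianRing R] : Function.Injective (algebraMap R (Completion R)) :=
  AdicCompletion.of_injective (maximalIdeal R) R

instance (R : Type u) [CommRing R] [IsLocalRing R] [IsNoetherianRing R] :
    FaithfulSMul R (Completion R) :=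
  (faithfulSMul_iff_algebraMap_injective R (Completion R)).2 (algebraMap_completion_injective R)

/-- The formal completion of a discrete valuation ring is a domain. -/
instance (R : Type u) [CommRing R] [IsDomain R] [IsDiscreteValuationRing R] :
    IsDomain (Completion R) := by
  obtain ⟨ϖ, hϖ⟩ := IsDiscreteValuationRing.exists_irreducible R
  have hmax := hϖ.maximalIdeal_eq
  set π : Completion R := algebraMap R (Completion R) ϖ with hπ
  have hmax' : maximalIdeal (Completion R) = Ideal.span {π} := by
    rw [AdicCompletion.maximalIdeal_eq_map,
      show Ideal.map (algebraMap R (Completion R)) (maximalIdeal R) =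
        Ideal.map (algebraMap R (Completion R)) (Ideal.span {ϖ}) from
          congrArg (Ideal.map (algebraMap R (Completion R))) hmax,
      Ideal.map_span, Set.image_singleton]
  have key : ∀ x : Completion R, x ≠ 0 → ∃ (n : ℕ) (u : Completion R), IsUnit u ∧ x = π ^ n * u := by
    intro x hx
    have h1 : ∃ n : ℕ, x ∉ maximalIdeal (Completion R) ^ n := by
      by_contra! hcon
      refine hx (IsHausdorff.haus (I := maximalIdeal (Completion R)) inferInstance x fun n => ?_)
      rw [SModEq.zero]
      simpa using hcon n
    classical
    obtain ⟨m, hm⟩ : ∃ m, Nat.find h1 = m + 1 := by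
      refine Nat.exists_eq_succ_of_ne_zero fun h0 => ?_
      have := Nat.find_spec h1
      rw [h0] at this
      simp at this
    have hin : x ∈ maximalIdeal (Completion R) ^ m := by
      have := Nat.find_min h1 (m := m) (by omega)
      simpa using this
    have hout := Nat.find_spec h1
    rw [hm, hmax', Ideal.span_singleton_pow, Ideal.mem_span_singleton] at hout
    rw [hmax', Ideal.span_singleton_pow, Ideal.mem_span_singleton] at hin
    obtain ⟨u, rfl⟩ := hin
    refine ⟨m, u, ?_, rfl⟩
    by_contra hu
    have hu' : u ∈ maximalIdeal (Completion R) := hu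
    rw [hmax', Ideal.mem_span_singleton] at hu'
    exact hout (by rw [pow_succ]; exact mul_dvd_mul_left _ hu')
  have hpow : ∀ n : ℕ, π ^ n ≠ 0 := by
    intro n h
    rw [hπ, ← map_pow, map_eq_zero_iff _ (algebraMap_completion_injective R)] at h
    exact pow_ne_zero n hϖ.ne_zero h
  have : NoZeroDivisors (Completion R) := by
    refine ⟨fun {x y} hxy => ?_⟩
    by_contra! hcon
    obtain ⟨a, u, hu, rfl⟩ := key x hcon.1
    obtain ⟨b, w, hw, rfl⟩ := key y hcon.2
    have h2 : π ^ (a + b) * (u * w) = 0 := by rw [← hxy]; ring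
    exact hpow (a + b) (((hu.mul hw).mul_left_eq_zero).1 h2)
  exact NoZeroDivisors.to_isDomain _

/-- The inclusion `Frac(R) ⊆ Frac(R̂)` of fields of fractions induced by `R ⊆ R̂`. -/
instance fracAlgebra (R : Type u) [CommRing R] [IsDomain R] [IsLocalRing R] [IsNoetherianRing R]
    [IsDomain (Completion R)] : Algebra (FractionRing R) (FractionRing (Completion R)) :=
  FractionRing.liftAlgebra R (FractionRing (Completion R))

section LocalHom

variable (R : Type u) (A : Type v) [CommRing R] [CommRing A] [IsLocalRing R] [IsLocalRing A]
  [Algebra R A] [IsLocalHom (algebraMap R A)]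

theorem maximalIdeal_pow_le_comap (n : ℕ) :
    maximalIdeal R ^ n ≤ (maximalIdeal A ^ n).comap (algebraMap R A) := by
  rw [← Ideal.map_le_iff_le_comap, Ideal.map_pow]
  have h : (maximalIdeal R).map (algebraMap R A) ≤ maximalIdeal A :=
    Ideal.map_le_iff_le_comap.2 (maximalIdeal_comap (algebraMap R A)).ge
  exact Ideal.pow_right_mono h n

/-- The map `R̂ → Â` induced on formal completions by a local homomorphism `R → A`:
the inverse limit of the maps `R / 𝔪_Rⁿ → A / 𝔪_Aⁿ`. -/
def completionMap : Completion R →+* Completion A :=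
  AdicCompletion.liftRingHom (maximalIdeal A)
    (fun n => (Ideal.quotientMap (maximalIdeal A ^ n) (algebraMap R A)
      (maximalIdeal_pow_le_comap R A n)).comp
        (AdicCompletion.evalₐ (maximalIdeal R) n : Completion R →+* R ⧸ maximalIdeal R ^ n))
    (by
      intro m n hle
      ext x
      obtain ⟨r, rfl⟩ := AdicCompletion.mk_surjective _ _ x
      simp only [RingHom.comp_apply, RingHom.coe_coe, AdicCompletion.evalₐ_mk,
        Ideal.quotientMap_mk]
      refine (Ideal.Quotient.eq).2 ?_
      rw [← map_sub]
      refine maximalIdeal_pow_le_comap R A m ?_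
      exact (Ideal.Quotient.eq).1 (AdicCompletion.Ideal.mk_eq_mk (maximalIdeal R) hle r))

end LocalHom

/-! ### Numerical invariants of an extension of local rings -/

/-- The ramification index `e = length_A (A / 𝔪_R A)`. -/
def ramificationIndex (R : Type u) (A : Type v) [CommRing R] [CommRing A] [IsLocalRing R]
    [Algebra R A] : ℕ∞ :=
  Module.length A (A ⧸ (maximalIdeal R).map (algebraMap R A))

/-- The residual degree `f = [κ(A) : κ(R)]`. -/
def residualDegree (R : Type u) (A : Type v) [CommRing R] [CommRing A] [IsLocalRing R]
    [IsLocalRing A] [Algebra R A] [IsLocalHom (algebraMap R A)] : ℕ∞ :=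
  Cardinal.toENat (Module.rank (ResidueField R) (ResidueField A))

/-- The degree `n = [A ⊗_R F : F]`, where `F = Frac(R)`. -/
def degree (R : Type u) (A : Type v) [CommRing R] [IsDomain R] [CommRing A] [Algebra R A] : ℕ∞ :=
  Cardinal.toENat (Module.rank (FractionRing R) (FractionRing R ⊗[R] A))

/-! ### Separable extensions -/

/-- A (not necessarily algebraic) field extension `K ⊆ L` is separable if `L ⊗_K K'` is reduced for
every field extension `K ⊆ K'`. (It suffices to take `K'` in the universe of `K`, since an
algebraic closure of `K` is enough.) -/
def IsSeparableExtension (K : Type u) (L : Type v) [Field K] [Field L] [Algebra K L] : Prop :=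
  ∀ (K' : Type u) [Field K'] [Algebra K K'], IsReduced (K' ⊗[K] L)

/-! ### Excellent local rings -/

/-- A ring is catenary if for primes `𝔭 ⊆ 𝔮` the lengths of the chains of primes from `𝔭` to `𝔮`
are bounded, and all saturated chains from `𝔭` to `𝔮` have the same length. -/
def IsCatenaryRing (B : Type u) [CommRing B] : Prop :=
  ∀ p q : PrimeSpectrum B, p ≤ q →
    (∃ N : ℕ, ∀ l : LTSeries (PrimeSpectrum B), l.head = p → l.last = q → l.length ≤ N) ∧
    ∀ l l' : RelSeries {(a, b) : PrimeSpectrum B × PrimeSpectrum B | a ⋖ b},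
      l.head = p → l.last = q → l'.head = p → l'.last = q → l.length = l'.length

/-- A noetherian ring is universally catenary if all its algebras of finite type are catenary. -/
structure IsUniversallyCatenary (A : Type u) [CommRing A] : Prop where
  isNoetherianRing : IsNoetherianRing A
  isCatenaryRing : ∀ (B : Type u) [CommRing B] [Algebra A B], Algebra.FiniteType A B →
    IsCatenaryRing B

/-- An algebra over a field is geometrically regular if it stays regular after every finite
extension of the ground field. -/
def IsGeometricallyRegular (k : Type u) (B : Type v) [Field k] [CommRing B] [Algebra k B] : Prop :=
  ∀ (k' : Type u) [Field k'] [Algebra k k'], Module.Finite k k' → IsRegularRing (k' ⊗[k] B)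

/-- A local ring is excellent if it is noetherian, universally catenary, and all formal fiber rings
`κ(𝔭) ⊗ R̂` are geometrically regular over `κ(𝔭)`. -/
structure IsExcellentLocalRing (R : Type u) [CommRing R] [IsLocalRing R] : Prop where
  isNoetherianRing : IsNoetherianRing R
  isUniversallyCatenary : IsUniversallyCatenary R
  isGeometricallyRegular : ∀ (p : Ideal R) [p.IsPrime],
    IsGeometricallyRegular p.ResidueField (p.Fiber (Completion R))

/-! ### The `p`-radical closure -/

section Closure

variable (R : Type u) [CommRing R] [IsDomain R] [IsLocalRing R] [IsNoetherianRing R]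

instance : ExpChar (Completion R) (ringExpChar (FractionRing R)) :=
  haveI : ExpChar R (ringExpChar (FractionRing R)) :=
    RingHom.expChar (algebraMap R (FractionRing R)) (IsFractionRing.injective R _) _
  expChar_of_injective_algebraMap (algebraMap_completion_injective R) _

/-- The `p`-radical closure: the set of `b ∈ R̂` with `b ^ (p ^ ν) ∈ R` for some `ν ≥ 0`, where `p`
is the characteristic exponent of `Frac(R)`. -/
def pRadicalClosure : Subalgebra R (Completion R) :=
  Subalgebra.perfectClosure R (Completion R) (ringExpChar (FractionRing R))

theorem mem_pRadicalClosure {b : Completion R} : b ∈ pRadicalClosure R ↔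
    ∃ ν : ℕ, b ^ ringExpChar (FractionRing R) ^ ν ∈ Set.range (algebraMap R (Completion R)) :=
  Iff.rfl

instance : IsLocalHom (algebraMap (pRadicalClosure R) (Completion R)) := by
  refine ⟨fun b hb => ?_⟩
  obtain ⟨ν, r, hr⟩ := (mem_pRadicalClosure R).1 b.2
  obtain ⟨c, hc⟩ := isUnit_iff_exists_inv.1 hb
  have hbc : (b : Completion R) * c = 1 := hc
  have hru : IsUnit r := by
    refine isUnit_of_map_unit (algebraMap R (Completion R)) r ?_
    rw [hr]
    exact hb.pow _
  obtain ⟨s, hs⟩ := isUnit_iff_exists_inv.1 hru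
  have hcm : c ∈ pRadicalClosure R := by
    refine (mem_pRadicalClosure R).2 ⟨ν, s, ?_⟩
    have h1 : algebraMap R (Completion R) r * algebraMap R (Completion R) s = 1 := by
      rw [← map_mul, hs, map_one]
    have h2 : algebraMap R (Completion R) r * c ^ ringExpChar (FractionRing R) ^ ν = 1 := by
      rw [hr, ← mul_pow, hbc, one_pow]
    calc algebraMap R (Completion R) s
        = algebraMap R (Completion R) s *
            (algebraMap R (Completion R) r * c ^ ringExpChar (FractionRing R) ^ ν) := by
          rw [h2, mul_one]
      _ = (algebraMap R (Completion R) r * algebraMap R (Completion R) s) *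
            c ^ ringExpChar (FractionRing R) ^ ν := by ring
      _ = c ^ ringExpChar (FractionRing R) ^ ν := by rw [h1, one_mul]
  exact isUnit_iff_exists_inv.2 ⟨⟨c, hcm⟩, Subtype.ext hbc⟩

instance : IsLocalRing (pRadicalClosure R) :=
  RingHom.domain_isLocalRing (algebraMap (pRadicalClosure R) (Completion R))

instance : IsLocalHom (algebraMap R (pRadicalClosure R)) := by
  refine ⟨fun r hr => ?_⟩
  have h := hr.map (algebraMap (pRadicalClosure R) (Completion R))
  exact isUnit_of_map_unit (algebraMap R (Completion R)) r h

end Closure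

end PRC

end

/-! Write `S` for the `p`-radical closure. Divisibility between elements of `R` can be tested in
`R̂`, so `S` is saturated: if `a * x ∈ S` with `a ≠ 0` in `R`, then `x ∈ S`
(`mem_pRadicalClosure_of_mul_mem`). Hence the factorizations `ϖ ^ n * u` and the approximations `r +
ϖ * y` available in `R̂` stay inside `S`. So `S` is a discrete valuation ring with the same
uniformizer and the same quotients modulo powers of the maximal ideal as `R`, which gives `e = f =
1` and `R̂ ≃ Ŝ`. The degree formula only uses that `S` is integral over `R`.

For excellence, the hypothesis on `F'` forces `F' = Frac(S)`. Separability puts `S` inside `F'`,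
because a separable extension contains no new `p`-power roots (`mem_range_of_pow_mem_range`); pure
inseparability makes each element of `F'` a quotient of elements of `S`
(`exists_div_of_pow_mem_range`). So `K ⊗ R̂` over `S` is reduced for all fields `K` containing `S`.
For a discrete valuation ring this is all that is needed (`isExcellentLocalRing_of_isReduced`): the
generic formal fiber is artinian, where reduced implies regular, the closed fiber is trivial, and
universal catenarity is automatic.

Finally, if `S` is finite over `R`, then Nakayama and `S = R + 𝔪S` give `S = R`, so `R` is
excellent. -/

noncomputable section

namespace PRC

universe u v w

/-! ### Catenarity of algebras of finite type over a discrete valuation ring -/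

/-! ### Isolated points of fibers and Zariski's main theorem. -/

section QuasiFinite

variable {A : Type u} {D : Type v} [CommRing A] [CommRing D] [Algebra A D] [Algebra.FiniteType A D]

/-- The fiber is noetherian and Jacobson, so a point that is both minimal and maximal in it is open.
-/
theorem quasiFiniteAt_of_isolated (q : PrimeSpectrum D)
    (hmin : ∀ q' : PrimeSpectrum D, q' ≤ q →
      q'.comap (algebraMap A D) = q.comap (algebraMap A D) → q' = q)
    (hmax : ∀ q' : PrimeSpectrum D, q ≤ q' →
      q'.comap (algebraMap A D) = q.comap (algebraMap A D) → q' = q) :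
    Algebra.QuasiFiniteAt A q.asIdeal := by
  refine Algebra.QuasiFiniteAt.of_isOpen_singleton_fiber q ?_
  set p := q.comap (algebraMap A D) with hp
  let e := PrimeSpectrum.preimageHomeomorphFiber A D p
  let o := PrimeSpectrum.preimageOrderIsoFiber A D p
  have : IsNoetherianRing (p.asIdeal.Fiber D) :=
    Algebra.FiniteType.isNoetherianRing p.asIdeal.ResidueField _
  have : IsJacobsonRing (p.asIdeal.Fiber D) :=
    isJacobsonRing_of_finiteType (A := p.asIdeal.ResidueField)
  rw [← e.isOpen_image, Set.image_singleton]
  rw [(PrimeSpectrum.isOpen_singleton_tfae_of_isNoetherian_of_isJacobsonRing _).out 0 2 rfl rfl,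
    PrimeSpectrum.isClosed_singleton_iff_isMaximal, ← PrimeSpectrum.isMax_iff,
    PrimeSpectrum.stableUnderGeneralization_singleton, ← PrimeSpectrum.isMin_iff]
  constructor
  · intro y hy
    obtain ⟨y, rfl⟩ := o.surjective y
    have h1 : (⟨q, rfl⟩ : PrimeSpectrum.comap (algebraMap A D) ⁻¹' {p}) ≤ y := o.le_iff_le.1 hy
    exact o.le_iff_le.2 (Subtype.coe_le_coe.1 (hmax y.1 h1 y.2).le)
  · intro y hy
    obtain ⟨y, rfl⟩ := o.surjective y
    have h1 : y ≤ (⟨q, rfl⟩ : PrimeSpectrum.comap (algebraMap A D) ⁻¹' {p}) := o.le_iff_le.1 hy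
    exact o.le_iff_le.2 (Subtype.coe_le_coe.1 (hmin y.1 h1 y.2).ge)

/-- A domain of finite type over `A` that is quasi-finite at one prime is algebraic over `A`. -/
theorem isAlgebraic_of_quasiFiniteAt [IsDomain D] [FaithfulSMul A D] (q : Ideal D) [q.IsPrime]
    [Algebra.QuasiFiniteAt A q] : Algebra.IsAlgebraic A D := by
  have : IsDomain A := (FaithfulSMul.algebraMap_injective A D).isDomain _
  obtain ⟨r, hrq, hr, H⟩ := Algebra.zariskisMainProperty_iff.1
    (Algebra.ZariskisMainProperty.of_finiteType (R := A) q)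
  refine ⟨fun x => ?_⟩
  obtain ⟨m, hm⟩ := H x
  have hr0 : r ≠ 0 := fun h => hrq (h ▸ q.zero_mem)
  have h1 : IsAlgebraic A (r ^ m) := (hr.pow m).isAlgebraic
  exact IsAlgebraic.of_mul (mem_nonZeroDivisors_of_ne_zero (pow_ne_zero m hr0)) h1 hm.isAlgebraic

/-- If `q` is a prime of height one in a domain `D` of finite type over `A ⊆ D`, if `q ∩ A ≠ 0` and
the extension `A / q ∩ A ⊆ D / q` is algebraic, then `D` is algebraic over `A`. -/
theorem isAlgebraic_of_height_one [IsDomain D] [FaithfulSMul A D] (q : Ideal D) [hqp : q.IsPrime]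
    (hq : ∀ q' : Ideal D, q'.IsPrime → q' ≤ q → q' ≠ ⊥ → q' = q)
    (hA : ∃ a : A, a ≠ 0 ∧ algebraMap A D a ∈ q)
    (halg : ∀ x : D, ∃ f : Polynomial A,
      f.map (Ideal.Quotient.mk (q.comap (algebraMap A D))) ≠ 0 ∧ Polynomial.aeval x f ∈ q) :
    Algebra.IsAlgebraic A D := by
  have : Algebra.QuasiFiniteAt A (⟨q, hqp⟩ : PrimeSpectrum D).asIdeal := by
    refine quasiFiniteAt_of_isolated (A := A) ⟨q, hqp⟩ ?_ ?_
    · intro q' hle heq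
      obtain ⟨a, ha, haq⟩ := hA
      refine PrimeSpectrum.ext (hq q'.asIdeal q'.2 hle ?_)
      intro hbot
      have h1 : a ∈ (q'.comap (algebraMap A D)).asIdeal := by rw [heq]; exact haq
      have h2 : algebraMap A D a ∈ q'.asIdeal := h1
      rw [hbot, Ideal.mem_bot] at h2
      exact ha ((map_eq_zero_iff _ (FaithfulSMul.algebraMap_injective A D)).1 h2)
    · intro q' hle heq
      refine PrimeSpectrum.ext (le_antisymm ?_ hle)
      intro x hx
      by_contra hxq
      obtain ⟨f, hf, hfx⟩ := halg x
      -- For `x ∈ q' \ q`, an algebraic relation modulo `q` has a coefficient in `q' ∩ A` outside `q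
      -- ∩ A`, so the two primes cannot lie in the same fiber.
      obtain ⟨i, hi, hi'⟩ := Ideal.exists_coeff_mem_comap_sdiff_comap_of_root_mem_sdiff
        (f := algebraMap A D) (I := q) (J := q'.asIdeal) hle ⟨hx, hxq⟩ hf hfx
      refine hi' ?_
      have h1 : f.coeff i ∈ (q'.comap (algebraMap A D)).asIdeal := hi
      rw [heq] at h1
      exact h1
  exact isAlgebraic_of_quasiFiniteAt (A := A) (⟨q, hqp⟩ : PrimeSpectrum D).asIdeal

end QuasiFinite

/-! ### Transcendence degree under specialization to a prime of height one. -/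

section Specialization

variable {A₁ A₂ : Type*} {D C : Type w} [CommRing A₁] [CommRing A₂] [CommRing D] [CommRing C]
  [IsDomain D] [IsDomain C] [Algebra A₁ D] [Algebra A₂ C] [FaithfulSMul A₂ C]
  [Algebra.FiniteType A₁ D] (g : A₁ →+* A₂) (f : D →+* C)

/-- Algebraic relations over `A₂[f ∘ y]` lift coefficientwise to `A₁[s]`, so the residue extension
at `ker f` is algebraic and `isAlgebraic_of_height_one` applies with base `A₁[s]`. -/
theorem isAlgebraic_adjoin_of_specialization (hg : Function.Surjective g)
    (hgf : (algebraMap A₂ C).comp g = f.comp (algebraMap A₁ D))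
    (hq : ∀ q' : Ideal D, q'.IsPrime → q' ≤ RingHom.ker f → q' ≠ ⊥ → q' = RingHom.ker f)
    {ι : Type*} (y : ι → D) (hy : IsTranscendenceBasis A₂ (f ∘ y)) (s : Set D)
    (hys : Set.range y ⊆ s) (hs : ∃ a ∈ Algebra.adjoin A₁ s, a ≠ 0 ∧ f a = 0) :
    Algebra.IsAlgebraic (Algebra.adjoin A₁ s) D := by
  have : IsDomain A₂ := (FaithfulSMul.algebraMap_injective A₂ C).isDomain _
  have hD : Algebra.FiniteType (Algebra.adjoin A₁ s) D :=
    Algebra.FiniteType.of_restrictScalars_finiteType A₁ _ D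
  have hkp : (RingHom.ker f).IsPrime := RingHom.ker_isPrime f
  have hlift : ∀ c ∈ Algebra.adjoin A₂ (Set.range (f ∘ y)),
      c ∈ Set.range (f.comp (algebraMap (Algebra.adjoin A₁ s) D)) := by
    intro c hc
    induction hc using Algebra.adjoin_induction with
    | mem x hx =>
      obtain ⟨i, rfl⟩ := hx
      exact ⟨⟨y i, Algebra.subset_adjoin (hys ⟨i, rfl⟩)⟩, rfl⟩
    | algebraMap r =>
      obtain ⟨r, rfl⟩ := hg r
      refine ⟨algebraMap A₁ _ r, ?_⟩
      exact (RingHom.congr_fun hgf r).symm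
    | add a b _ _ ha hb =>
      obtain ⟨a, rfl⟩ := ha
      obtain ⟨b, rfl⟩ := hb
      exact ⟨a + b, map_add _ a b⟩
    | mul a b _ _ ha hb =>
      obtain ⟨a, rfl⟩ := ha
      obtain ⟨b, rfl⟩ := hb
      exact ⟨a * b, map_mul _ a b⟩
  refine isAlgebraic_of_height_one (RingHom.ker f) hq ?_ ?_
  · obtain ⟨a, ha, ha0, hfa⟩ := hs
    exact ⟨⟨a, ha⟩, fun h => ha0 (congrArg Subtype.val h), hfa⟩
  · intro x
    obtain ⟨P, hP0, hP⟩ := hy.isAlgebraic.isAlgebraic (f x)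
    have hmem : P.map (algebraMap _ C) ∈
        Polynomial.lifts (f.comp (algebraMap (Algebra.adjoin A₁ s) D)) := by
      rw [Polynomial.lifts_iff_coeff_lifts]
      intro n
      rw [Polynomial.coeff_map]
      exact hlift _ (P.coeff n).2
    obtain ⟨P', hP'⟩ := (Polynomial.mem_lifts _).1 hmem
    refine ⟨P', fun h0 => hP0 ?_, ?_⟩
    · refine Polynomial.map_injective (algebraMap _ C) Subtype.val_injective ?_
      rw [← hP', Polynomial.map_zero]
      ext n
      have h1 := congrArg (fun p => Polynomial.coeff p n) h0
      simp only [Polynomial.coeff_map, Polynomial.coeff_zero, Ideal.Quotient.eq_zero_iff_mem] at h1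
      rw [Polynomial.coeff_map, Polynomial.coeff_zero]
      exact h1
    · rw [RingHom.mem_ker, Polynomial.aeval_def, Polynomial.hom_eval₂, ← Polynomial.eval_map, hP',
        Polynomial.eval_map]
      exact hP

variable [FaithfulSMul A₁ D]

/-- The case within one fiber: lifting a transcendence basis of `C` and adding one nonzero `t ∈ ker
f` gives a transcendence basis of `D`. -/
theorem trdeg_specialization_of_bijective (hg : Function.Bijective g) (hf : Function.Surjective f)
    (hgf : (algebraMap A₂ C).comp g = f.comp (algebraMap A₁ D)) (hker : RingHom.ker f ≠ ⊥)
    (hq : ∀ q' : Ideal D, q'.IsPrime → q' ≤ RingHom.ker f → q' ≠ ⊥ → q' = RingHom.ker f) :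
    Algebra.trdeg A₁ D = Algebra.trdeg A₂ C + 1 := by
  have : IsDomain A₁ := (FaithfulSMul.algebraMap_injective A₁ D).isDomain _
  have : IsDomain A₂ := (FaithfulSMul.algebraMap_injective A₂ C).isDomain _
  obtain ⟨ι, z, hz⟩ := exists_isTranscendenceBasis' A₂ C
  choose y hy using fun i => hf (z i)
  have hfy : f ∘ y = z := funext hy
  have hcomp : AlgebraicIndependent A₂ (f ∘ y) := hfy ▸ hz.1
  have hind : AlgebraicIndependent A₁ y := hcomp.of_ringHom_of_comp_eq g f hg.1 hgf
  obtain ⟨t, htf, ht0⟩ := Submodule.exists_mem_ne_zero_of_ne_bot hker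
  have hft : f t = 0 := htf
  have htr : Transcendental (Algebra.adjoin A₁ (Set.range y)) t := by
    intro halg
    -- An algebraic `t` would divide a nonzero `r ∈ A₁[y]`; then `f r = 0` contradicts the
    -- independence of `f ∘ y`.
    obtain ⟨r, hr0, hr⟩ := halg.exists_nonzero_dvd (mem_nonZeroDivisors_of_ne_zero ht0)
    have hfr : f r = 0 := by
      obtain ⟨c, hc⟩ := hr
      have h1 : (r : D) = t * c := hc
      rw [h1, map_mul, hft, zero_mul]
    refine hr0 (Subtype.ext ?_)
    obtain ⟨P, hP⟩ : ∃ P, MvPolynomial.aeval y P = (r : D) :=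
      (Algebra.adjoin_range_eq_range_aeval A₁ y).le r.2
    have h2 : MvPolynomial.aeval (f ∘ y) (MvPolynomial.map g P) = 0 := by
      rw [← hP, MvPolynomial.aeval_def, ← MvPolynomial.coe_eval₂Hom,
        MvPolynomial.map_eval₂Hom, MvPolynomial.coe_eval₂Hom, ← hgf] at hfr
      rw [MvPolynomial.aeval_def, MvPolynomial.eval₂_map]
      exact hfr
    have h3 := MvPolynomial.map_injective g hg.1
      (((algebraicIndependent_iff.1 hcomp) _ h2).trans (map_zero _).symm)
    rw [← hP, h3, map_zero]
    rfl
  have hopt := (hind.option_iff_transcendental t).2 htr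
  have halg : Algebra.IsAlgebraic
      (Algebra.adjoin A₁ (Set.range fun o : Option ι => o.elim t y)) D := by
    refine isAlgebraic_adjoin_of_specialization g f hg.2 hgf hq y (hfy ▸ hz) _ ?_
      ⟨t, Algebra.subset_adjoin ⟨none, rfl⟩, ht0, hft⟩
    rintro _ ⟨i, rfl⟩
    exact ⟨some i, rfl⟩
  rw [← (hopt.isTranscendenceBasis_iff_isAlgebraic.2 halg).cardinalMk_eq_trdeg,
    ← hz.cardinalMk_eq_trdeg, Cardinal.mk_option]

/-- The case from generic to closed fiber: `π` itself is the nonzero element of `ker f`, so the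
lifted basis needs no extra member. -/
theorem trdeg_specialization_of_ker (hg : Function.Surjective g) (hf : Function.Surjective f)
    (hgf : (algebraMap A₂ C).comp g = f.comp (algebraMap A₁ D)) (π : A₁) (hπ : π ≠ 0)
    (hgπ : RingHom.ker g = Ideal.span {π}) (hsep : ∀ a : A₁, (∀ n, π ^ n ∣ a) → a = 0)
    (hq : ∀ q' : Ideal D, q'.IsPrime → q' ≤ RingHom.ker f → q' ≠ ⊥ → q' = RingHom.ker f) :
    Algebra.trdeg A₁ D = Algebra.trdeg A₂ C := by
  have : IsDomain A₁ := (FaithfulSMul.algebraMap_injective A₁ D).isDomain _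
  have : IsDomain A₂ := (FaithfulSMul.algebraMap_injective A₂ C).isDomain _
  obtain ⟨ι, z, hz⟩ := exists_isTranscendenceBasis' A₂ C
  choose y hy using fun i => hf (z i)
  have hfy : f ∘ y = z := funext hy
  have hind : AlgebraicIndependent A₁ y := by
    rw [algebraicIndependent_iff]
    intro P hP
    -- A relation on `y` reduces modulo `π` to one on `f ∘ y`, hence to zero. Divide by `π` and
    -- repeat; separatedness then kills `P`.
    have key : ∀ n, MvPolynomial.C (π ^ n) ∣ P := by
      intro n
      induction n with
      | zero => simp
      | succ n ih =>
        obtain ⟨Q, rfl⟩ := ih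
        have h1 : MvPolynomial.aeval y Q = 0 := by
          rw [map_mul, ← MvPolynomial.algebraMap_eq, AlgHom.commutes] at hP
          refine (mul_eq_zero.1 hP).resolve_left ?_
          exact (map_ne_zero_iff _ (FaithfulSMul.algebraMap_injective A₁ D)).2 (pow_ne_zero n hπ)
        have h2 : MvPolynomial.aeval (f ∘ y) (MvPolynomial.map g Q) = 0 := by
          have h3 := congrArg f h1
          rw [map_zero, MvPolynomial.aeval_def, ← MvPolynomial.coe_eval₂Hom,
            MvPolynomial.map_eval₂Hom, MvPolynomial.coe_eval₂Hom, ← hgf] at h3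
          rw [MvPolynomial.aeval_def, MvPolynomial.eval₂_map]
          exact h3
        rw [hfy] at h2
        have h3 := (algebraicIndependent_iff.1 hz.1) _ h2
        rw [pow_succ, MvPolynomial.C_mul]
        refine mul_dvd_mul_left _ (MvPolynomial.C_dvd_iff_dvd_coeff _ _ |>.2 fun m => ?_)
        rw [← Ideal.mem_span_singleton, ← hgπ, RingHom.mem_ker, ← MvPolynomial.coeff_map, h3,
          MvPolynomial.coeff_zero]
    ext m
    exact hsep _ fun n => (MvPolynomial.C_dvd_iff_dvd_coeff _ _).1 (key n) m
  have halg : Algebra.IsAlgebraic (Algebra.adjoin A₁ (Set.range y)) D := by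
    refine isAlgebraic_adjoin_of_specialization g f hg hgf hq y (hfy ▸ hz) _ subset_rfl
      ⟨algebraMap A₁ D π, Subalgebra.algebraMap_mem _ π, ?_, ?_⟩
    · rwa [map_ne_zero_iff _ (FaithfulSMul.algebraMap_injective A₁ D)]
    · have h1 : g π = 0 := by
        rw [← RingHom.mem_ker, hgπ]; exact Ideal.mem_span_singleton_self π
      have h2 := RingHom.congr_fun hgf π
      rw [RingHom.comp_apply, h1, map_zero] at h2
      exact h2.symm
  rw [← (hind.isTranscendenceBasis_iff_isAlgebraic.2 halg).cardinalMk_eq_trdeg,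
    ← hz.cardinalMk_eq_trdeg]

end Specialization

/-! ### A dimension function and universal catenarity. -/

section Catenary

variable (T B : Type u) [CommRing T] [CommRing B] [Algebra T B]

/-- The dimension function of an algebra of finite type over a discrete valuation ring. -/
def dimFunction (p : PrimeSpectrum B) : ℕ :=
  open Classical in
  Cardinal.toNat (Algebra.trdeg (T ⧸ p.asIdeal.under T) (B ⧸ p.asIdeal)) +
    if p.asIdeal.under T = ⊥ then 1 else 0

variable [IsDomain T] [IsDiscreteValuationRing T] [Algebra.FiniteType T B]

/-- If `p` and `q` have the same contraction to `T`, the transcendence degree drops by one.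
Otherwise the contractions are `⊥` and the maximal ideal, the transcendence degree is unchanged and
the summand `1` disappears. -/
theorem dimFunction_eq_of_covBy {p q : PrimeSpectrum B} (h : p ⋖ q) :
    dimFunction T B p = dimFunction T B q + 1 := by
  have hle : p.asIdeal ≤ q.asIdeal := h.le
  have hle' : p.asIdeal.under T ≤ q.asIdeal.under T := Ideal.comap_mono hle
  let f : B ⧸ p.asIdeal →+* B ⧸ q.asIdeal := Ideal.Quotient.factor hle
  let g : T ⧸ p.asIdeal.under T →+* T ⧸ q.asIdeal.under T := Ideal.Quotient.factor hle'
  have hf : Function.Surjective f := Ideal.Quotient.factor_surjective hle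
  have hg : Function.Surjective g := Ideal.Quotient.factor_surjective hle'
  have hgf : (algebraMap (T ⧸ q.asIdeal.under T) (B ⧸ q.asIdeal)).comp g =
      f.comp (algebraMap (T ⧸ p.asIdeal.under T) (B ⧸ p.asIdeal)) := by
    ext x
    rfl
  have hkerf : ∀ b : B, Ideal.Quotient.mk p.asIdeal b ∈ RingHom.ker f ↔ b ∈ q.asIdeal := by
    intro b
    rw [RingHom.mem_ker, Ideal.Quotient.factor_mk, Ideal.Quotient.eq_zero_iff_mem]
  have hker : RingHom.ker f ≠ ⊥ := by
    obtain ⟨b, hbq, hbp⟩ := SetLike.exists_of_lt (show p.asIdeal < q.asIdeal from h.lt)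
    intro hbot
    have h1 := (hkerf b).2 hbq
    rw [hbot, Ideal.mem_bot, Ideal.Quotient.eq_zero_iff_mem] at h1
    exact hbp h1
  have hq : ∀ q' : Ideal (B ⧸ p.asIdeal), q'.IsPrime → q' ≤ RingHom.ker f → q' ≠ ⊥ →
      q' = RingHom.ker f := by
    intro q' hq' hle2 hne
    let r : PrimeSpectrum B := ⟨q'.comap (Ideal.Quotient.mk p.asIdeal), inferInstance⟩
    have hpr : p < r := by
      refine lt_of_le_of_ne (fun b hb => ?_) (fun heq => hne ?_)
      · change Ideal.Quotient.mk p.asIdeal b ∈ q'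
        rw [Ideal.Quotient.eq_zero_iff_mem.2 hb]
        exact q'.zero_mem
      · rw [eq_bot_iff]
        intro x hx
        obtain ⟨b, rfl⟩ := Ideal.Quotient.mk_surjective x
        have h1 : b ∈ r.asIdeal := hx
        rw [← heq] at h1
        exact Ideal.Quotient.eq_zero_iff_mem.2 h1
    have hrq : r ≤ q := fun b hb => (hkerf b).1 (hle2 hb)
    have hrq' : r = q := by
      by_contra hne'
      exact h.2 hpr (lt_of_le_of_ne hrq hne')
    refine le_antisymm hle2 fun x hx => ?_
    obtain ⟨b, rfl⟩ := Ideal.Quotient.mk_surjective x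
    have h1 : b ∈ q.asIdeal := (hkerf b).1 hx
    rw [← hrq'] at h1
    exact h1
  -- Finiteness matters because `Cardinal.toNat` sends infinite cardinals to `0` and is not additive
  -- there.
  have hfin : Algebra.trdeg (T ⧸ q.asIdeal.under T) (B ⧸ q.asIdeal) < Cardinal.aleph0 :=
    trdeg_lt_aleph0_of_finiteType
  by_cases heq : p.asIdeal.under T = q.asIdeal.under T
  · have hgb : Function.Bijective g := by
      refine ⟨?_, hg⟩
      rw [injective_iff_map_eq_zero]
      intro x hx
      obtain ⟨t, rfl⟩ := Ideal.Quotient.mk_surjective x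
      rw [Ideal.Quotient.factor_mk, Ideal.Quotient.eq_zero_iff_mem, ← heq] at hx
      exact Ideal.Quotient.eq_zero_iff_mem.2 hx
    have h1 := trdeg_specialization_of_bijective g f hgb hf hgf hker hq
    rw [dimFunction, dimFunction, h1, heq, Cardinal.toNat_add hfin Cardinal.one_lt_aleph0,
      Cardinal.one_toNat]
    ring
  · obtain ⟨ϖ, hϖ⟩ := IsDiscreteValuationRing.exists_irreducible T
    have hcase : ∀ I : Ideal T, I.IsPrime → I ≠ ⊥ → I = maximalIdeal T := fun I hI hne =>
      IsLocalRing.eq_maximalIdeal (hI.isMaximal hne)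
    have hp0 : p.asIdeal.under T = ⊥ := by
      by_contra hne
      refine heq ((hcase _ inferInstance hne).trans (hcase _ inferInstance ?_).symm)
      exact fun hbot => hne (le_bot_iff.1 (hbot ▸ hle'))
    have hq0 : q.asIdeal.under T ≠ ⊥ := fun hbot => heq (hp0.trans hbot.symm)
    have hqm := hcase _ inferInstance hq0
    have h1 := trdeg_specialization_of_ker g f hg hf hgf (Ideal.Quotient.mk _ ϖ) ?_ ?_ ?_ hq
    · rw [dimFunction, dimFunction, h1, if_pos hp0, if_neg hq0]
    · rw [Ne, Ideal.Quotient.eq_zero_iff_mem, hp0]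
      exact hϖ.ne_zero
    · ext x
      obtain ⟨t, rfl⟩ := Ideal.Quotient.mk_surjective x
      rw [RingHom.mem_ker, Ideal.Quotient.factor_mk, Ideal.Quotient.eq_zero_iff_mem, hqm,
        hϖ.maximalIdeal_eq, Ideal.mem_span_singleton, Ideal.mem_span_singleton]
      refine ⟨map_dvd _, ?_⟩
      rintro ⟨c, hc⟩
      obtain ⟨s, rfl⟩ := Ideal.Quotient.mk_surjective c
      rw [← map_mul, Ideal.Quotient.eq, hp0, Ideal.mem_bot, sub_eq_zero] at hc
      exact ⟨s, hc⟩
    · intro x hx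
      obtain ⟨t, rfl⟩ := Ideal.Quotient.mk_surjective x
      have h2 : ∀ n, t ∈ maximalIdeal T ^ n := by
        intro n
        obtain ⟨c, hc⟩ := hx n
        obtain ⟨s, rfl⟩ := Ideal.Quotient.mk_surjective c
        rw [← map_pow, ← map_mul, Ideal.Quotient.eq, hp0, Ideal.mem_bot, sub_eq_zero] at hc
        rw [hϖ.maximalIdeal_eq, Ideal.span_singleton_pow, Ideal.mem_span_singleton]
        exact ⟨s, hc⟩
      have h3 : t = 0 := IsHausdorff.haus (I := maximalIdeal T) inferInstance t fun n => by
        rw [SModEq.zero]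
        simpa using h2 n
      rw [h3, map_zero]

/-- The length of a saturated chain is the difference of `dimFunction` at its ends; the bound for
all chains is the finite height of `q` in a noetherian ring. -/
theorem isCatenaryRing_of_finiteType (T B : Type u) [CommRing T] [CommRing B] [Algebra T B]
    [IsDomain T] [IsDiscreteValuationRing T] [Algebra.FiniteType T B] : IsCatenaryRing B := by
  have hB : IsNoetherianRing B := Algebra.FiniteType.isNoetherianRing T B
  intro p q _
  have key : ∀ (n : ℕ) (l : RelSeries {(a, b) : PrimeSpectrum B × PrimeSpectrum B | a ⋖ b}),
      l.length = n → dimFunction T B l.head = dimFunction T B l.last + n := by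
    intro n
    induction n with
    | zero =>
      intro l hl
      have h1 : l.head = l.last := congrArg l.toFun (Fin.ext (by simp [hl]))
      rw [h1, add_zero]
    | succ n ih =>
      intro l hl
      have h1 := ih (l.eraseLast) (by rw [RelSeries.eraseLast_length, hl]; rfl)
      have h2 : l.eraseLast.last ⋖ l.last := l.eraseLast_last_rel_last (by omega)
      rw [RelSeries.head_eraseLast] at h1
      rw [h1, dimFunction_eq_of_covBy T B h2]
      ring
  refine ⟨?_, ?_⟩
  · have hfin : Order.height q ≠ ⊤ := by
      have h1 : q.asIdeal.height ≠ ⊤ := Ideal.height_ne_top q.2.ne_top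
      rwa [PrimeSpectrum.height_eq_orderHeight] at h1
    refine ⟨(Order.height q).toNat, fun l _ hl => ?_⟩
    have h2 : (l.length : ℕ∞) ≤ Order.height q := hl ▸ Order.length_le_height_last
    rw [← ENat.natCast_toNat hfin] at h2
    exact_mod_cast h2
  · intro l l' h1 h2 h3 h4
    have e1 := key _ l rfl
    have e2 := key _ l' rfl
    rw [h1, h2] at e1
    rw [h3, h4] at e2
    omega

theorem isUniversallyCatenary_of_isDiscreteValuationRing : IsUniversallyCatenary T where
  isNoetherianRing := inferInstance
  isCatenaryRing B _ _ _ := isCatenaryRing_of_finiteType T B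

end Catenary

/-! ### Descent from the completion to the closure: uniformizer, residue field, quotients. -/

section DVR

variable {R : Type u} [CommRing R] [IsDomain R] [IsDiscreteValuationRing R]

theorem maximalIdeal_completion {ϖ : R} (hϖ : Irreducible ϖ) :
    maximalIdeal (Completion R) = Ideal.span {algebraMap R (Completion R) ϖ} := by
  rw [AdicCompletion.maximalIdeal_eq_map,
    show Ideal.map (algebraMap R (Completion R)) (maximalIdeal R) =
      Ideal.map (algebraMap R (Completion R)) (Ideal.span {ϖ}) from
        congrArg (Ideal.map (algebraMap R (Completion R))) hϖ.maximalIdeal_eq,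
    Ideal.map_span, Set.image_singleton]

theorem exists_eq_pow_mul_unit_completion {ϖ : R} (hϖ : Irreducible ϖ) (x : Completion R)
    (hx : x ≠ 0) : ∃ (n : ℕ) (u : Completion R), IsUnit u ∧
      x = algebraMap R (Completion R) ϖ ^ n * u := by
  have hmax := maximalIdeal_completion hϖ
  have h1 : ∃ n : ℕ, x ∉ maximalIdeal (Completion R) ^ n := by
    by_contra! hcon
    refine hx (IsHausdorff.haus (I := maximalIdeal (Completion R)) inferInstance x fun n => ?_)
    rw [SModEq.zero]
    simpa using hcon n
  classical
  obtain ⟨m, hm⟩ : ∃ m, Nat.find h1 = m + 1 := by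
    refine Nat.exists_eq_succ_of_ne_zero fun h0 => ?_
    have := Nat.find_spec h1
    rw [h0] at this
    simp at this
  have hin : x ∈ maximalIdeal (Completion R) ^ m := by
    have := Nat.find_min h1 (m := m) (by omega)
    simpa using this
  have hout := Nat.find_spec h1
  rw [hm, hmax, Ideal.span_singleton_pow, Ideal.mem_span_singleton] at hout
  rw [hmax, Ideal.span_singleton_pow, Ideal.mem_span_singleton] at hin
  obtain ⟨u, rfl⟩ := hin
  refine ⟨m, u, ?_, rfl⟩
  by_contra hu
  have hu' : u ∈ maximalIdeal (Completion R) := hu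
  rw [hmax, Ideal.mem_span_singleton] at hu'
  exact hout (by rw [pow_succ]; exact mul_dvd_mul_left _ hu')

instance : IsLocalHom (algebraMap R (Completion R)) := by
  refine ⟨fun r hr => ?_⟩
  obtain ⟨ϖ, hϖ⟩ := IsDiscreteValuationRing.exists_irreducible R
  by_contra hcon
  have h1 : r ∈ maximalIdeal R := hcon
  rw [hϖ.maximalIdeal_eq, Ideal.mem_span_singleton] at h1
  have h2 : algebraMap R (Completion R) r ∈ maximalIdeal (Completion R) := by
    rw [maximalIdeal_completion hϖ, Ideal.mem_span_singleton]
    exact map_dvd _ h1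
  exact h2 hr

/-- In a valuation ring the only other possibility is `a = r * c`; then `c` is a unit in `R̂`, hence
in `R`. -/
theorem dvd_of_algebraMap_dvd {a r : R}
    (h : algebraMap R (Completion R) a ∣ algebraMap R (Completion R) r) : a ∣ r := by
  rcases ValuationRing.dvd_total a r with h1 | ⟨c, rfl⟩
  · exact h1
  by_cases hr : r = 0
  · rw [hr]; exact dvd_zero _
  obtain ⟨d, hd⟩ := h
  have h2 : algebraMap R (Completion R) r * (algebraMap R (Completion R) c * d) =
      algebraMap R (Completion R) r * 1 := by
    rw [mul_one, ← mul_assoc, ← map_mul]; exact hd.symm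
  have h3 := mul_left_cancel₀
    ((map_ne_zero_iff _ (algebraMap_completion_injective R)).2 hr) h2
  have h4 : IsUnit c := isUnit_of_map_unit (algebraMap R (Completion R)) c (.of_mul_eq_one _ h3)
  exact (h4.mul_right_dvd).2 dvd_rfl

theorem exists_eq_add_mul_completion {ϖ : R} (hϖ : Irreducible ϖ) (x : Completion R) :
    ∃ (r : R) (y : Completion R),
      x = algebraMap R (Completion R) r + algebraMap R (Completion R) ϖ * y := by
  obtain ⟨r, hr⟩ := Ideal.Quotient.mk_surjective (AdicCompletion.evalₐ (maximalIdeal R) 1 x)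
  have h1 : x - algebraMap R (Completion R) r ∈ maximalIdeal (Completion R) := by
    intro hu
    have h2 := hu.map (AdicCompletion.evalₐ (maximalIdeal R) 1)
    have h3 : AdicCompletion.evalₐ (maximalIdeal R) 1 (x - algebraMap R (Completion R) r) = 0 := by
      rw [map_sub, AlgHom.commutes, sub_eq_zero, ← hr]
      rfl
    rw [h3, isUnit_zero_iff, Ideal.Quotient.zero_eq_one_iff, pow_one] at h2
    exact (maximalIdeal.isMaximal R).ne_top h2
  rw [maximalIdeal_completion hϖ, Ideal.mem_span_singleton] at h1
  obtain ⟨y, hy⟩ := h1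
  exact ⟨r, y, by rw [← hy]; ring⟩

/-- Take a `p`-power that brings the product into `R` and divide there by the power of `a`. Through
this saturation the structure of `R̂` passes to the closure. -/
theorem mem_pRadicalClosure_of_mul_mem {a : R} (ha : a ≠ 0) {x : Completion R}
    (h : algebraMap R (Completion R) a * x ∈ pRadicalClosure R) : x ∈ pRadicalClosure R := by
  obtain ⟨ν, r, hr⟩ := (mem_pRadicalClosure R).1 h
  rw [mul_pow, ← map_pow] at hr
  obtain ⟨s, rfl⟩ := dvd_of_algebraMap_dvd (Dvd.intro _ hr.symm)
  rw [map_mul] at hr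
  exact (mem_pRadicalClosure R).2 ⟨ν, s, mul_left_cancel₀
    ((map_ne_zero_iff _ (algebraMap_completion_injective R)).2 (pow_ne_zero _ ha)) hr⟩

theorem exists_eq_pow_mul_unit_pRadicalClosure {ϖ : R} (hϖ : Irreducible ϖ)
    (x : pRadicalClosure R) (hx : x ≠ 0) : ∃ (n : ℕ) (u : pRadicalClosure R), IsUnit u ∧
      x = algebraMap R (pRadicalClosure R) ϖ ^ n * u := by
  obtain ⟨n, u, hu, h⟩ := exists_eq_pow_mul_unit_completion hϖ (x : Completion R)
    fun h => hx (Subtype.ext h)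
  have hmem : u ∈ pRadicalClosure R := by
    refine mem_pRadicalClosure_of_mul_mem (pow_ne_zero n hϖ.ne_zero) ?_
    rw [map_pow, ← h]
    exact x.2
  exact ⟨n, ⟨u, hmem⟩, isUnit_of_map_unit (algebraMap (pRadicalClosure R) (Completion R)) _ hu,
    Subtype.ext h⟩

theorem exists_eq_add_mul_pRadicalClosure {ϖ : R} (hϖ : Irreducible ϖ) (x : pRadicalClosure R) :
    ∃ (r : R) (y : pRadicalClosure R),
      x = algebraMap R (pRadicalClosure R) r + algebraMap R (pRadicalClosure R) ϖ * y := by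
  obtain ⟨r, y, h⟩ := exists_eq_add_mul_completion hϖ (x : Completion R)
  have hmem : y ∈ pRadicalClosure R := by
    refine mem_pRadicalClosure_of_mul_mem hϖ.ne_zero ?_
    rw [← sub_eq_iff_eq_add'.2 h]
    exact sub_mem x.2 (Subalgebra.algebraMap_mem _ r)
  exact ⟨r, ⟨y, hmem⟩, Subtype.ext h⟩

theorem exists_eq_add_pow_mul_pRadicalClosure {ϖ : R} (hϖ : Irreducible ϖ) (n : ℕ)
    (x : pRadicalClosure R) : ∃ (r : R) (y : pRadicalClosure R),
      x = algebraMap R (pRadicalClosure R) r + algebraMap R (pRadicalClosure R) ϖ ^ n * y := by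
  induction n with
  | zero => exact ⟨0, x, by simp⟩
  | succ n ih =>
    obtain ⟨r, y, rfl⟩ := ih
    obtain ⟨s, z, rfl⟩ := exists_eq_add_mul_pRadicalClosure hϖ y
    exact ⟨r + ϖ ^ n * s, z, by rw [map_add, map_mul, map_pow]; ring⟩

theorem irreducible_algebraMap_pRadicalClosure {ϖ : R} (hϖ : Irreducible ϖ) :
    Irreducible (algebraMap R (pRadicalClosure R) ϖ) := by
  have hprime : Prime (algebraMap R (Completion R) ϖ) := by
    rw [← Ideal.span_singleton_prime
      ((map_ne_zero_iff _ (algebraMap_completion_injective R)).2 hϖ.ne_zero),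
      ← maximalIdeal_completion hϖ]
    exact (maximalIdeal.isMaximal _).isPrime
  refine ⟨fun h => hϖ.not_isUnit (isUnit_of_map_unit _ _ h), fun a b hab => ?_⟩
  have h1 : algebraMap R (Completion R) ϖ = (a : Completion R) * b := congrArg Subtype.val hab
  rcases hprime.irreducible.isUnit_or_isUnit h1 with h | h
  · exact Or.inl (isUnit_of_map_unit (algebraMap (pRadicalClosure R) (Completion R)) a h)
  · exact Or.inr (isUnit_of_map_unit (algebraMap (pRadicalClosure R) (Completion R)) b h)

instance : IsDiscreteValuationRing (pRadicalClosure R) := by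
  obtain ⟨ϖ, hϖ⟩ := IsDiscreteValuationRing.exists_irreducible R
  refine IsDiscreteValuationRing.ofHasUnitMulPowIrreducibleFactorization
    ⟨_, irreducible_algebraMap_pRadicalClosure hϖ, fun {x} hx => ?_⟩
  obtain ⟨n, u, hu, rfl⟩ := exists_eq_pow_mul_unit_pRadicalClosure hϖ x hx
  exact ⟨n, hu.unit, rfl⟩

theorem map_maximalIdeal_pRadicalClosure :
    (maximalIdeal R).map (algebraMap R (pRadicalClosure R)) =
      maximalIdeal (pRadicalClosure R) := by
  obtain ⟨ϖ, hϖ⟩ := IsDiscreteValuationRing.exists_irreducible R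
  calc (maximalIdeal R).map (algebraMap R (pRadicalClosure R))
      = (Ideal.span {ϖ}).map (algebraMap R (pRadicalClosure R)) :=
        congrArg (Ideal.map (algebraMap R (pRadicalClosure R))) hϖ.maximalIdeal_eq
    _ = Ideal.span {algebraMap R (pRadicalClosure R) ϖ} := by
        rw [Ideal.map_span, Set.image_singleton]
    _ = maximalIdeal (pRadicalClosure R) :=
        (irreducible_algebraMap_pRadicalClosure hϖ).maximalIdeal_eq.symm

theorem ramificationIndex_eq_one {R : Type u} {A : Type v} [CommRing R] [CommRing A]
    [IsLocalRing R] [IsLocalRing A] [Algebra R A]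
    (h : (maximalIdeal R).map (algebraMap R A) = maximalIdeal A) : ramificationIndex R A = 1 := by
  have hs : IsSimpleModule A (A ⧸ maximalIdeal A) :=
    isSimpleModule_iff_isCoatom.2 (Ideal.isMaximal_def.1 (maximalIdeal.isMaximal A))
  rw [ramificationIndex, h]
  exact Module.length_eq_one A _

theorem residualDegree_eq_one {R : Type u} {A : Type v} [CommRing R] [CommRing A] [IsLocalRing R]
    [IsLocalRing A] [Algebra R A] [IsLocalHom (algebraMap R A)]
    (h : Function.Surjective (algebraMap (ResidueField R) (ResidueField A))) :
    residualDegree R A = 1 := by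
  have e : ResidueField R ≃ₗ[ResidueField R] ResidueField A :=
    LinearEquiv.ofBijective (Algebra.linearMap (ResidueField R) (ResidueField A))
      ⟨(algebraMap (ResidueField R) (ResidueField A)).injective, h⟩
  have h1 := e.lift_rank_eq
  rw [Module.rank_self, Cardinal.lift_one, eq_comm, Cardinal.lift_eq_one] at h1
  rw [residualDegree, h1, map_one]

theorem ramificationIndex_pRadicalClosure : ramificationIndex R (pRadicalClosure R) = 1 :=
  ramificationIndex_eq_one map_maximalIdeal_pRadicalClosure

theorem residualDegree_pRadicalClosure : residualDegree R (pRadicalClosure R) = 1 := by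
  obtain ⟨ϖ, hϖ⟩ := IsDiscreteValuationRing.exists_irreducible R
  refine residualDegree_eq_one fun y => ?_
  obtain ⟨x, rfl⟩ := residue_surjective y
  obtain ⟨r, z, rfl⟩ := exists_eq_add_mul_pRadicalClosure hϖ x
  refine ⟨residue R r, ?_⟩
  rw [map_add, map_mul, (residue_eq_zero_iff _).2
    ((mem_maximalIdeal _).2 (irreducible_algebraMap_pRadicalClosure hϖ).not_isUnit), zero_mul,
    add_zero]
  rfl

theorem quotientMap_bijective_pRadicalClosure (n : ℕ) : Function.Bijective
    (Ideal.quotientMap (maximalIdeal (pRadicalClosure R) ^ n) (algebraMap R (pRadicalClosure R))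
      (maximalIdeal_pow_le_comap R (pRadicalClosure R) n)) := by
  obtain ⟨ϖ, hϖ⟩ := IsDiscreteValuationRing.exists_irreducible R
  have hS := (irreducible_algebraMap_pRadicalClosure hϖ).maximalIdeal_eq
  constructor
  · rw [injective_iff_map_eq_zero]
    intro x hx
    obtain ⟨r, rfl⟩ := Ideal.Quotient.mk_surjective x
    rw [Ideal.quotientMap_mk, Ideal.Quotient.eq_zero_iff_mem, hS, Ideal.span_singleton_pow,
      Ideal.mem_span_singleton, ← map_pow] at hx
    rw [Ideal.Quotient.eq_zero_iff_mem, hϖ.maximalIdeal_eq, Ideal.span_singleton_pow,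
      Ideal.mem_span_singleton]
    exact dvd_of_algebraMap_dvd (map_dvd (algebraMap (pRadicalClosure R) (Completion R)) hx)
  · intro y
    obtain ⟨x, rfl⟩ := Ideal.Quotient.mk_surjective y
    obtain ⟨r, z, rfl⟩ := exists_eq_add_pow_mul_pRadicalClosure hϖ n x
    refine ⟨Ideal.Quotient.mk _ r, ?_⟩
    rw [Ideal.quotientMap_mk, Ideal.Quotient.eq, sub_add_cancel_left, neg_mem_iff, hS,
      Ideal.span_singleton_pow]
    exact Ideal.mul_mem_right _ _ (Ideal.mem_span_singleton_self _)

end DVR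

/-! ### The induced map on formal completions. -/

section CompletionMap

variable (R : Type u) (A : Type v) [CommRing R] [CommRing A] [IsLocalRing R] [IsLocalRing A]
  [Algebra R A] [IsLocalHom (algebraMap R A)]

theorem quotientMap_evalₐ_compatible {m n : ℕ} (hle : m ≤ n) :
    (Ideal.Quotient.factorPow (maximalIdeal A) hle).comp
      ((Ideal.quotientMap (maximalIdeal A ^ n) (algebraMap R A)
        (maximalIdeal_pow_le_comap R A n)).comp
          (AdicCompletion.evalₐ (maximalIdeal R) n : Completion R →+* R ⧸ maximalIdeal R ^ n)) =
      (Ideal.quotientMap (maximalIdeal A ^ m) (algebraMap R A)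
        (maximalIdeal_pow_le_comap R A m)).comp
          (AdicCompletion.evalₐ (maximalIdeal R) m : Completion R →+* R ⧸ maximalIdeal R ^ m) := by
  ext x
  obtain ⟨r, rfl⟩ := AdicCompletion.mk_surjective _ _ x
  simp only [RingHom.comp_apply, RingHom.coe_coe, AdicCompletion.evalₐ_mk, Ideal.quotientMap_mk]
  refine (Ideal.Quotient.eq).2 ?_
  rw [← map_sub]
  refine maximalIdeal_pow_le_comap R A m ?_
  exact (Ideal.Quotient.eq).1 (AdicCompletion.Ideal.mk_eq_mk (maximalIdeal R) hle r)

theorem evalₐ_completionMap (n : ℕ) (x : Completion R) :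
    AdicCompletion.evalₐ (maximalIdeal A) n (completionMap R A x) =
      Ideal.quotientMap (maximalIdeal A ^ n) (algebraMap R A) (maximalIdeal_pow_le_comap R A n)
        (AdicCompletion.evalₐ (maximalIdeal R) n x) := by
  unfold completionMap
  exact AdicCompletion.evalₐ_liftRingHom (maximalIdeal A) _ (quotientMap_evalₐ_compatible R A) n x

theorem completionMap_bijective (h : ∀ n, Function.Bijective (Ideal.quotientMap
    (maximalIdeal A ^ n) (algebraMap R A) (maximalIdeal_pow_le_comap R A n))) :
    Function.Bijective (completionMap R A) := by
  constructor
  · rw [injective_iff_map_eq_zero]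
    intro x hx
    refine AdicCompletion.ext_evalₐ fun n => (h n).1 ?_
    rw [← evalₐ_completionMap, hx, map_zero, map_zero, map_zero]
  · intro y
    let e := fun n => RingEquiv.ofBijective _ (h n)
    -- The inverses of the level maps are compatible with the transition maps, so they assemble to a
    -- preimage of `y`.
    have he : ∀ {m n : ℕ} (hle : m ≤ n) (z : R ⧸ maximalIdeal R ^ n),
        e m (Ideal.Quotient.factorPow _ hle z) = Ideal.Quotient.factorPow _ hle (e n z) := by
      intro m n hle z
      obtain ⟨r, rfl⟩ := Ideal.Quotient.mk_surjective z
      rfl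
    have hcompat : ∀ {m n : ℕ} (hle : m ≤ n),
        (Ideal.Quotient.factorPow (maximalIdeal R) hle).comp
          (((e n).symm : A ⧸ maximalIdeal A ^ n →+* R ⧸ maximalIdeal R ^ n).comp
            (AdicCompletion.evalₐ (maximalIdeal A) n : Completion A →+* _)) =
          ((e m).symm : A ⧸ maximalIdeal A ^ m →+* R ⧸ maximalIdeal R ^ m).comp
            (AdicCompletion.evalₐ (maximalIdeal A) m : Completion A →+* _) := by
      intro m n hle
      ext z
      obtain ⟨a, rfl⟩ := AdicCompletion.mk_surjective _ _ z
      refine (e m).injective ?_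
      simp only [RingHom.comp_apply, RingHom.coe_coe, he, RingEquiv.apply_symm_apply,
        AdicCompletion.evalₐ_mk]
      refine (Ideal.Quotient.eq).2 ?_
      exact (Ideal.Quotient.eq).1 (AdicCompletion.Ideal.mk_eq_mk (maximalIdeal A) hle a)
    refine ⟨AdicCompletion.liftRingHom (maximalIdeal R) _ hcompat y, ?_⟩
    refine AdicCompletion.ext_evalₐ fun n => ?_
    rw [evalₐ_completionMap, AdicCompletion.evalₐ_liftRingHom]
    exact (e n).apply_symm_apply _

/-- The map on completions is `A`-linear for every compatible map `A → R̂`. -/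
theorem completionMap_apply_eq_algebraMap (i : A →+* Completion R) (a : A)
    (h : ∀ n, ∃ r : R, a - algebraMap R A r ∈ maximalIdeal A ^ n ∧
      AdicCompletion.evalₐ (maximalIdeal R) n (i a) = Ideal.Quotient.mk _ r) :
    completionMap R A (i a) = algebraMap A (Completion A) a := by
  refine AdicCompletion.ext_evalₐ fun n => ?_
  obtain ⟨r, hr, hn⟩ := h n
  rw [evalₐ_completionMap, hn, Ideal.quotientMap_mk, AlgHom.commutes]
  exact ((Ideal.Quotient.eq).2 hr).symm

end CompletionMap

section DVR

variable {R : Type u} [CommRing R] [IsDomain R] [IsDiscreteValuationRing R]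

theorem completionMap_pRadicalClosure_bijective :
    Function.Bijective (completionMap R (pRadicalClosure R)) := by
  have h := completionMap_bijective R (pRadicalClosure R)
  have h2 := quotientMap_bijective_pRadicalClosure (R := R)
  exact h fun n => h2 n

/-- This makes the bijection of completions linear over the closure, so that reducedness of `K ⊗ R̂`
can be carried over to the closure's own completion. -/
theorem completionMap_coe_pRadicalClosure (s : pRadicalClosure R) :
    completionMap R (pRadicalClosure R) (algebraMap (pRadicalClosure R) (Completion R) s) =
      algebraMap (pRadicalClosure R) (Completion (pRadicalClosure R)) s := by
  refine completionMap_apply_eq_algebraMap R (pRadicalClosure R)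
    (algebraMap (pRadicalClosure R) (Completion R)) s fun n => ?_
  obtain ⟨ϖ, hϖ⟩ := IsDiscreteValuationRing.exists_irreducible R
  have hS := (irreducible_algebraMap_pRadicalClosure hϖ).maximalIdeal_eq
  obtain ⟨r, z, rfl⟩ := exists_eq_add_pow_mul_pRadicalClosure hϖ n s
  refine ⟨r, ?_, ?_⟩
  · rw [add_sub_cancel_left, hS, Ideal.span_singleton_pow]
    exact Ideal.mul_mem_right _ _ (Ideal.mem_span_singleton_self _)
  · have h2 : algebraMap (pRadicalClosure R) (Completion R)
        (algebraMap R (pRadicalClosure R) r + algebraMap R (pRadicalClosure R) ϖ ^ n * z) =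
        algebraMap R (Completion R) r + algebraMap R (Completion R) (ϖ ^ n) * z := by
      rw [map_pow]
      rfl
    have h3 : algebraMap R (R ⧸ maximalIdeal R ^ n) (ϖ ^ n) = 0 :=
      Ideal.Quotient.eq_zero_iff_mem.2
        (Ideal.pow_mem_pow ((mem_maximalIdeal _).2 hϖ.not_isUnit) n)
    rw [h2, map_add, map_mul, AlgHom.commutes, AlgHom.commutes, h3, zero_mul, add_zero]
    rfl

end DVR

/-! ### Degree as a supremum of ranks, and integrality. -/

section Degree

variable (R A : Type u) [CommRing R] [IsDomain R] [CommRing A] [Algebra R A]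

theorem degree_eq_toENat_rank : degree R A = Cardinal.toENat (Module.rank R A) := by
  have : IsLocalizedModule (nonZeroDivisors R) (TensorProduct.mk R (FractionRing R) A 1) :=
    (isLocalizedModule_iff_isBaseChange (nonZeroDivisors R) (FractionRing R) _).2
      (TensorProduct.isBaseChange R A (FractionRing R))
  rw [degree, IsLocalization.rank_eq (R := R) (FractionRing R) (nonZeroDivisors R) le_rfl,
    IsLocalizedModule.rank_eq (nonZeroDivisors R) le_rfl (TensorProduct.mk R (FractionRing R) A 1)]

theorem degree_eq_iSup_finrank [Algebra.IsIntegral R A] :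
    degree R A = ⨆ B : {B : Subalgebra R A // Module.Finite R B}, (Module.finrank R B.1 : ℕ∞) := by
  rw [degree_eq_toENat_rank]
  -- Testing against natural numbers `m` covers infinite degree too: `m` independent elements
  -- generate a subalgebra that is finite by integrality.
  refine le_antisymm (ENat.forall_natCast_le_iff_le.1 fun m hm => ?_) (iSup_le fun B => ?_)
  · rw [Cardinal.natCast_le_toENat, Module.le_rank_iff_exists_finset] at hm
    obtain ⟨s, hs, hind⟩ := hm
    have hfin : Module.Finite R (Algebra.adjoin R (s : Set A)) :=
      Module.Finite.of_fg
        (fg_adjoin_of_finite s.finite_toSet fun x _ => Algebra.IsIntegral.isIntegral x)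
    refine le_trans ?_ (le_iSup (fun B : {B : Subalgebra R A // Module.Finite R B} =>
      (Module.finrank R B.1 : ℕ∞)) ⟨Algebra.adjoin R (s : Set A), hfin⟩)
    have h1 : LinearIndependent R
        (fun x : s => (⟨x, Algebra.subset_adjoin x.2⟩ : Algebra.adjoin R (s : Set A))) :=
      LinearIndependent.of_comp (Algebra.adjoin R (s : Set A)).val.toLinearMap hind
    have h2 := h1.fintype_card_le_finrank
    rw [Fintype.card_coe, hs] at h2
    exact_mod_cast h2
  · have := B.2
    rw [Cardinal.natCast_le_toENat, Module.finrank_eq_rank]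
    exact Submodule.rank_le (Subalgebra.toSubmodule B.1)

end Degree

section Integral

instance (R : Type u) [CommRing R] [IsDomain R] [IsLocalRing R] [IsNoetherianRing R] :
    Algebra.IsIntegral R (pRadicalClosure R) := by
  refine ⟨fun b => ?_⟩
  obtain ⟨ν, r, hr⟩ := (mem_pRadicalClosure R).1 b.2
  refine IsIntegral.of_pow (n := ringExpChar (FractionRing R) ^ ν)
    (pow_pos (expChar_pos (FractionRing R) _) ν) ?_
  have h : algebraMap R (pRadicalClosure R) r = b ^ ringExpChar (FractionRing R) ^ ν :=
    Subtype.ext hr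
  rw [← h]
  exact isIntegral_algebraMap

end Integral

/-! ### Formal fibers and excellence of discrete valuation rings. -/

theorem isRegularRing_of_isArtinianRing_of_isReduced (B : Type*) [CommRing B] [IsArtinianRing B]
    [IsReduced B] : IsRegularRing B := by
  rw [isRegularRing_iff]
  intro p hp
  let : Field (Localization.AtPrime p) :=
    IsField.toField (IsArtinianRing.isField_of_isReduced_of_isLocalRing _)
  infer_instance

theorem isArtinianRing_of_forall_isUnit (B : Type*) [CommRing B]
    (h : ∀ x : B, x ≠ 0 → IsUnit x) : IsArtinianRing B := by
  cases subsingleton_or_nontrivial B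
  · infer_instance
  · let : Field B := IsField.toField
      ⟨exists_pair_ne B, mul_comm, fun hx => isUnit_iff_exists_inv.1 (h _ hx)⟩
    infer_instance

theorem isReduced_and_isArtinianRing_of_surjective {K B : Type*} [Field K] [CommRing B]
    (f : K →+* B) (hf : Function.Surjective f) : IsReduced B ∧ IsArtinianRing B := by
  refine ⟨⟨fun b hb => ?_⟩, hf.isArtinianRing⟩
  obtain ⟨a, rfl⟩ := hf b
  by_cases ha : a = 0
  · rw [ha, map_zero]
  · have h1 : IsUnit (f a) := (isUnit_iff_ne_zero.2 ha).map f
    obtain ⟨n, hn⟩ := hb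
    have h2 : IsUnit (0 : B) := hn ▸ h1.pow n
    have := isUnit_zero_iff.1 h2
    rw [← mul_one (f a), ← this, mul_zero]

section Fibers

variable {T : Type u} {C : Type v} [CommRing T] [CommRing C] [Algebra T C] {ϖ : T}

/-- Up to a unit, each element of the fiber comes from `C`, where nonzero elements are units once
`ϖ` is inverted. So nonzero elements of the fiber are units. -/
theorem isArtinianRing_genericFiber [IsDomain T] (hϖ : ϖ ≠ 0)
    (hC : ∀ s : C, s ≠ 0 → ∃ (n : ℕ) (u : C), IsUnit u ∧ s = algebraMap T C ϖ ^ n * u)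
    (p : Ideal T) [p.IsPrime] (hp : p = ⊥) : IsArtinianRing (p.Fiber C) := by
  refine isArtinianRing_of_forall_isUnit _ fun x hx => ?_
  have hunit : ∀ r : T, r ≠ 0 → IsUnit (algebraMap T (p.Fiber C) r) := by
    intro r hr
    rw [IsScalarTower.algebraMap_apply T p.ResidueField]
    refine RingHom.isUnit_map _ (isUnit_iff_ne_zero.2 fun h => hr ?_)
    rw [Ideal.algebraMap_residueField_eq_zero, hp, Ideal.mem_bot] at h
    exact h
  obtain ⟨r, hr, s, hs⟩ := Ideal.Fiber.exists_smul_eq_one_tmul p x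
  rw [Algebra.smul_def] at hs
  have hr0 : r ≠ 0 := fun h => hr (h ▸ p.zero_mem)
  have hs0 : s ≠ 0 := by
    rintro rfl
    rw [TensorProduct.tmul_zero] at hs
    exact hx ((hunit r hr0).mul_right_eq_zero.1 hs)
  obtain ⟨n, u, hu, rfl⟩ := hC s hs0
  have h1 : (1 : p.ResidueField) ⊗ₜ[T] (algebraMap T C ϖ ^ n * u) =
      algebraMap T (p.Fiber C) (ϖ ^ n) * (1 ⊗ₜ u) := by
    rw [← map_pow, ← Algebra.smul_def, ← Algebra.smul_def, TensorProduct.tmul_smul]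
  have h2 : IsUnit ((1 : p.ResidueField) ⊗ₜ[T] u) :=
    hu.map (Algebra.TensorProduct.includeRight : C →ₐ[T] p.Fiber C)
  have h3 : IsUnit (algebraMap T (p.Fiber C) r * x) := by
    rw [hs, h1]
    exact (hunit _ (pow_ne_zero n hϖ)).mul h2
  exact isUnit_of_mul_isUnit_right h3

/-- Every element of `C` is congruent modulo `ϖ` to one from `T`, and `ϖ` vanishes in this fiber. -/
theorem algebraMap_fiber_surjective (hC : ∀ c : C, ∃ (r : T) (y : C),
      c = algebraMap T C r + algebraMap T C ϖ * y)
    (p : Ideal T) [p.IsPrime] (hp : ϖ ∈ p) :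
    Function.Surjective (algebraMap p.ResidueField (p.Fiber C)) := by
  have hϖp : algebraMap T p.ResidueField ϖ = 0 := Ideal.algebraMap_residueField_eq_zero.2 hp
  have key : ∀ (a : p.ResidueField) (c : C), ∃ b, algebraMap p.ResidueField (p.Fiber C) b =
      a ⊗ₜ[T] c := by
    intro a c
    obtain ⟨r, y, rfl⟩ := hC c
    refine ⟨r • a, ?_⟩
    have h0 : ϖ • a = 0 := by rw [Algebra.smul_def, hϖp, zero_mul]
    rw [TensorProduct.tmul_add, ← Algebra.smul_def, TensorProduct.tmul_smul,
      TensorProduct.smul_tmul', h0, TensorProduct.zero_tmul, add_zero, ← mul_one (algebraMap _ _ r),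
      ← Algebra.smul_def, TensorProduct.tmul_smul, TensorProduct.smul_tmul']
    rfl
  intro x
  induction x using TensorProduct.induction_on with
  | zero => exact ⟨0, map_zero _⟩
  | add x y hx hy =>
    obtain ⟨a, rfl⟩ := hx
    obtain ⟨b, rfl⟩ := hy
    exact ⟨a + b, map_add _ a b⟩
  | tmul a c => exact key a c

/-- Base change to `k'` gives `k' ⊗[T] C`, reduced by assumption, and it is artinian because it is
finite over the artinian fiber. -/
theorem isGeometricallyRegular_genericFiber {T : Type u} [CommRing T] [IsDomain T] {C : Type v}
    [CommRing C] [Algebra T C] (p : Ideal T) [p.IsPrime] (hp : p = ⊥)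
    (hC : IsArtinianRing (p.Fiber C))
    (h : ∀ (K : Type u) [Field K] [Algebra T K] [FaithfulSMul T K], IsReduced (K ⊗[T] C)) :
    IsGeometricallyRegular p.ResidueField (p.Fiber C) := by
  intro k' _ _ hfin
  let : Algebra T k' :=
    ((algebraMap p.ResidueField k').comp (algebraMap T p.ResidueField)).toAlgebra
  have : IsScalarTower T p.ResidueField k' := IsScalarTower.of_algebraMap_eq fun _ => rfl
  have : FaithfulSMul T k' := by
    rw [faithfulSMul_iff_algebraMap_injective, injective_iff_map_eq_zero]
    intro a ha
    have h1 : algebraMap p.ResidueField k' (algebraMap T p.ResidueField a) = 0 := ha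
    rw [map_eq_zero, Ideal.algebraMap_residueField_eq_zero, hp, Ideal.mem_bot] at h1
    exact h1
  have := h k'
  have : IsReduced (k' ⊗[p.ResidueField] p.Fiber C) :=
    isReduced_of_injective
      (Algebra.TensorProduct.cancelBaseChange T p.ResidueField k' k' C) (AlgEquiv.injective _)
  have : IsArtinianRing (p.Fiber C ⊗[p.ResidueField] k') :=
    IsArtinianRing.of_finite (p.Fiber C) (p.Fiber C ⊗[p.ResidueField] k')
  have : IsArtinianRing (k' ⊗[p.ResidueField] p.Fiber C) :=
    (Algebra.TensorProduct.comm p.ResidueField (p.Fiber C) k').toRingEquiv.isArtinianRing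
  exact isRegularRing_of_isArtinianRing_of_isReduced _

theorem isGeometricallyRegular_of_surjective {k : Type u} {B : Type v} [Field k] [CommRing B]
    [Algebra k B] (h : Function.Surjective (algebraMap k B)) : IsGeometricallyRegular k B := by
  intro k' _ _ _
  obtain ⟨h1, h2⟩ := isReduced_and_isArtinianRing_of_surjective
    (Algebra.TensorProduct.includeLeft : k' →ₐ[k'] k' ⊗[k] B).toRingHom
    (Algebra.TensorProduct.includeLeft_surjective k' k' h)
  exact isRegularRing_of_isArtinianRing_of_isReduced _

end Fibers

/-- A discrete valuation ring `T` is excellent if `K ⊗ T̂` is reduced for all field extensions `K`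
of its field of fractions. -/
theorem isExcellentLocalRing_of_isReduced (T : Type u) [CommRing T] [IsDomain T]
    [IsDiscreteValuationRing T]
    (h : ∀ (K : Type u) [Field K] [Algebra T K] [FaithfulSMul T K],
      IsReduced (K ⊗[T] Completion T)) : IsExcellentLocalRing T where
  isNoetherianRing := inferInstance
  isUniversallyCatenary := isUniversallyCatenary_of_isDiscreteValuationRing T
  isGeometricallyRegular p hp := by
    obtain ⟨ϖ, hϖ⟩ := IsDiscreteValuationRing.exists_irreducible T
    by_cases hp0 : p = ⊥
    · exact isGeometricallyRegular_genericFiber p hp0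
        (isArtinianRing_genericFiber hϖ.ne_zero (exists_eq_pow_mul_unit_completion hϖ) p hp0) h
    · have hpm : p = maximalIdeal T := IsLocalRing.eq_maximalIdeal (hp.isMaximal hp0)
      refine isGeometricallyRegular_of_surjective
        (algebraMap_fiber_surjective (exists_eq_add_mul_completion hϖ) p ?_)
      rw [hpm]
      exact hϖ.not_isUnit

/-! ### Consequences of separability. -/

theorem mem_range_of_pow_mem_range {K L : Type u} [Field K] [Field L] [Algebra K L]
    (hsep : IsSeparableExtension K L) (q : ℕ) [ExpChar K q] (n : ℕ) (y : L)
    (hy : y ^ q ^ n ∈ (algebraMap K L).range) : y ∈ (algebraMap K L).range := by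
  have hred : IsReduced (L ⊗[K] L) := hsep L
  obtain ⟨c, hc⟩ := hy
  have : ExpChar (L ⊗[K] L) q := expChar_of_injective_ringHom (algebraMap K (L ⊗[K] L)).injective q
  -- By Frobenius this element is nilpotent in the reduced ring `L ⊗[K] L`, hence zero; a `K`-linear
  -- retraction `φ : L → K` then turns `y ⊗ 1 = 1 ⊗ y` into `y = φ y`.
  have h1 : (y ⊗ₜ[K] (1 : L) - (1 : L) ⊗ₜ[K] y) ^ q ^ n = 0 := by
    rw [sub_pow_expChar_pow, Algebra.TensorProduct.tmul_pow, Algebra.TensorProduct.tmul_pow,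
      one_pow, ← hc, sub_eq_zero, Algebra.algebraMap_eq_smul_one, TensorProduct.tmul_smul,
      TensorProduct.smul_tmul']
  have h2 : y ⊗ₜ[K] (1 : L) = (1 : L) ⊗ₜ[K] y :=
    sub_eq_zero.1 (pow_eq_zero_iff (pow_ne_zero n (expChar_ne_zero K q)) |>.1 h1)
  obtain ⟨φ, hφ⟩ := LinearMap.exists_leftInverse_of_injective (Algebra.linearMap K L)
    (LinearMap.ker_eq_bot.2 (algebraMap K L).injective)
  have hφ1 : φ 1 = 1 := by
    have h3 := LinearMap.congr_fun hφ 1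
    simpa using h3
  have h4 := congrArg (TensorProduct.rid K L ∘ LinearMap.lTensor L φ) h2
  simp only [Function.comp_apply, LinearMap.lTensor_tmul, TensorProduct.rid_tmul, hφ1,
    one_smul] at h4
  exact ⟨φ y, (Algebra.algebraMap_eq_smul_one _).trans h4.symm⟩

/-- By flatness of `K` over `S`, the ring embeds into `K ⊗[S] L`, which equals `K ⊗[k] L` because
`k` is a localization of `S`. -/
theorem isReduced_tensorProduct_of_isSeparableExtension {S C k L : Type u} [CommRing S]
    [IsDomain S] [CommRing C] [Field k] [Field L] [Algebra S C] [Algebra C L] [Algebra S L]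
    [IsScalarTower S C L] [FaithfulSMul C L] [Algebra S k] [IsFractionRing S k] [Algebra k L]
    [IsScalarTower S k L] (hsep : IsSeparableExtension k L)
    (K : Type u) [Field K] [Algebra S K] [FaithfulSMul S K] : IsReduced (K ⊗[S] C) := by
  let : Algebra k K :=
    (IsFractionRing.lift (K := k) (FaithfulSMul.algebraMap_injective S K)).toAlgebra
  have : IsScalarTower S k K := IsScalarTower.of_algebraMap_eq fun x =>
    (IsFractionRing.lift_algebraMap (FaithfulSMul.algebraMap_injective S K) x).symm
  have hred : IsReduced (K ⊗[k] L) := hsep K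
  have hcomp : TensorProduct.CompatibleSMul S k K L :=
    IsLocalization.tensorProduct_compatibleSMul (nonZeroDivisors S) k K L
  have hred' : IsReduced (K ⊗[S] L) :=
    isReduced_of_injective (Algebra.TensorProduct.equivOfCompatibleSMul k S k K L)
      (AlgEquiv.injective _)
  have : Module.Flat S k := IsLocalization.flat k (nonZeroDivisors S)
  have : Module.Flat S K := Module.Flat.trans S k K
  refine isReduced_of_injective
    (Algebra.TensorProduct.map (AlgHom.id S K) (IsScalarTower.toAlgHom S C L)) ?_
  exact Module.Flat.lTensor_preserves_injective_linearMap (M := K)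
    (IsScalarTower.toAlgHom S C L).toLinearMap (FaithfulSMul.algebraMap_injective C L)

/-! ### Identification of `F'` with the field of fractions of the closure. -/

section Frac

variable (R : Type u) [CommRing R] [IsDomain R] [IsDiscreteValuationRing R]

instance : IsScalarTower R (FractionRing R) (FractionRing (Completion R)) :=
  FractionRing.isScalarTower_liftAlgebra R _

variable {R} (F' : IntermediateField (FractionRing R) (FractionRing (Completion R)))

theorem algebraMap_mem_of_isSeparableExtension
    (hsep : IsSeparableExtension F' (FractionRing (Completion R))) {b : Completion R}
    (hb : b ∈ pRadicalClosure R) : algebraMap (Completion R) (FractionRing (Completion R)) b ∈ F' := by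
  obtain ⟨ν, r, hr⟩ := (mem_pRadicalClosure R).1 hb
  have : ExpChar F' (ringExpChar (FractionRing R)) :=
    expChar_of_injective_algebraMap (algebraMap (FractionRing R) F').injective _
  obtain ⟨x, hx⟩ := mem_range_of_pow_mem_range hsep (ringExpChar (FractionRing R)) ν
    (algebraMap (Completion R) (FractionRing (Completion R)) b) (by
      refine ⟨algebraMap (FractionRing R) F' (algebraMap R (FractionRing R) r), ?_⟩
      rw [← map_pow, ← hr, ← IsScalarTower.algebraMap_apply R (Completion R)
        (FractionRing (Completion R)), IsScalarTower.algebraMap_apply R (FractionRing R)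
        (FractionRing (Completion R))]
      rfl)
  rw [← hx]
  exact x.2

/-- Denominators in `R̂` are a power of `ϖ` times a unit, so `z = c / d` with `d ∈ R`. Then `c ^ q`
lies in `R̂ ∩ Frac(R)`, which is `R` by descent of divisibility. -/
theorem exists_div_of_pow_mem_range {q : ℕ} {z : FractionRing (Completion R)}
    (hz : z ^ q ∈ (algebraMap (FractionRing R) (FractionRing (Completion R))).range) :
    ∃ (c : Completion R) (d : R), d ≠ 0 ∧ c ^ q ∈ Set.range (algebraMap R (Completion R)) ∧
      z = algebraMap (Completion R) (FractionRing (Completion R)) c /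
        algebraMap R (FractionRing (Completion R)) d := by
  obtain ⟨ϖ, hϖ⟩ := IsDiscreteValuationRing.exists_irreducible R
  obtain ⟨x, y, hy, rfl⟩ := IsFractionRing.div_surjective (A := Completion R) z
  obtain ⟨n, u, hu, rfl⟩ :=
    exists_eq_pow_mul_unit_completion hϖ y (nonZeroDivisors.ne_zero hy)
  obtain ⟨u, rfl⟩ := hu
  have hinj := IsFractionRing.injective (Completion R) (FractionRing (Completion R))
  have hinjR := algebraMap_completion_injective R
  have hd : algebraMap R (FractionRing (Completion R)) (ϖ ^ n) ≠ 0 := by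
    rw [IsScalarTower.algebraMap_apply R (Completion R), map_ne_zero_iff _ hinj,
      map_ne_zero_iff _ hinjR]
    exact pow_ne_zero n hϖ.ne_zero
  have hz' : algebraMap (Completion R) (FractionRing (Completion R)) x /
      algebraMap (Completion R) (FractionRing (Completion R))
        (algebraMap R (Completion R) ϖ ^ n * u) =
      algebraMap (Completion R) (FractionRing (Completion R)) (x * (u⁻¹ : (Completion R)ˣ)) /
        algebraMap R (FractionRing (Completion R)) (ϖ ^ n) := by
    rw [div_eq_div_iff ?_ hd, IsScalarTower.algebraMap_apply R (Completion R)
      (FractionRing (Completion R)), ← map_mul, ← map_mul, map_pow]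
    · congr 1
      calc x * algebraMap R (Completion R) ϖ ^ n
          = x * algebraMap R (Completion R) ϖ ^ n * (u * (u⁻¹ : (Completion R)ˣ)) := by
            rw [Units.mul_inv, mul_one]
        _ = _ := by ring
    · exact (map_ne_zero_iff _ hinj).2 (nonZeroDivisors.ne_zero hy)
  rw [hz'] at hz ⊢
  refine ⟨_, _, pow_ne_zero n hϖ.ne_zero, ?_, rfl⟩
  generalize x * ((u⁻¹ : (Completion R)ˣ) : Completion R) = c at hz ⊢
  obtain ⟨w, hw⟩ := hz
  obtain ⟨a, b, hb, rfl⟩ := IsFractionRing.div_surjective (A := R) w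
  have hb0 : algebraMap R (FractionRing (Completion R)) b ≠ 0 := by
    rw [IsScalarTower.algebraMap_apply R (Completion R), map_ne_zero_iff _ hinj,
      map_ne_zero_iff _ hinjR]
    exact nonZeroDivisors.ne_zero hb
  rw [map_div₀, ← IsScalarTower.algebraMap_apply, ← IsScalarTower.algebraMap_apply, div_pow,
    div_eq_div_iff hb0 (pow_ne_zero q hd), ← map_pow, ← map_pow,
    IsScalarTower.algebraMap_apply R (Completion R) (FractionRing (Completion R)),
    IsScalarTower.algebraMap_apply R (Completion R) (FractionRing (Completion R)),
    IsScalarTower.algebraMap_apply R (Completion R) (FractionRing (Completion R)),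
    ← map_mul, ← map_mul, ← map_mul] at hw
  have h1 := hinj hw
  obtain ⟨s, hs⟩ := dvd_of_algebraMap_dvd (Dvd.intro_left _ h1.symm)
  refine ⟨s, mul_right_cancel₀ ((map_ne_zero_iff _ hinjR).2 (nonZeroDivisors.ne_zero hb)) ?_⟩
  rw [← h1, ← map_mul, hs, mul_comm]

/-- If `Frac(R) ⊆ F'` is purely inseparable and `F' ⊆ Frac(R̂)` is separable, then `F'` is the field
of fractions of the `p`-radical closure, and the latter has geometrically reduced completion. -/
theorem isReduced_tensorProduct_completion [hpi : IsPurelyInseparable (FractionRing R) F']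
    (hsep : IsSeparableExtension F' (FractionRing (Completion R)))
    (K : Type u) [Field K] [Algebra (pRadicalClosure R) K] [FaithfulSMul (pRadicalClosure R) K] :
    IsReduced (K ⊗[pRadicalClosure R] Completion R) := by
  let i : pRadicalClosure R →+* F' :=
    ((algebraMap (Completion R) (FractionRing (Completion R))).comp
      (algebraMap (pRadicalClosure R) (Completion R))).codRestrict F'
      fun b => algebraMap_mem_of_isSeparableExtension F' hsep b.2
  let : Algebra (pRadicalClosure R) F' := i.toAlgebra
  have : IsScalarTower (pRadicalClosure R) F' (FractionRing (Completion R)) :=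
    IsScalarTower.of_algebraMap_eq fun _ => rfl
  have hinj := IsFractionRing.injective (Completion R) (FractionRing (Completion R))
  have : FaithfulSMul (pRadicalClosure R) F' := by
    rw [faithfulSMul_iff_algebraMap_injective]
    intro a b hab
    exact Subtype.ext (hinj (congrArg Subtype.val hab))
  have : IsFractionRing (pRadicalClosure R) F' := by
    refine IsFractionRing.of_field _ _ fun z => ?_
    obtain ⟨n, w, hw⟩ := IsPurelyInseparable.pow_mem (FractionRing R)
      (ringExpChar (FractionRing R)) z
    obtain ⟨c, d, hd, hc, hz⟩ := exists_div_of_pow_mem_range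
      (z := (z : FractionRing (Completion R))) ⟨w, congrArg Subtype.val hw⟩
    refine ⟨⟨c, (mem_pRadicalClosure R).2 ⟨n, hc⟩⟩, algebraMap R (pRadicalClosure R) d,
      Subtype.ext ?_⟩
    exact hz
  exact isReduced_tensorProduct_of_isSeparableExtension hsep K

end Frac

theorem isReduced_tensorProduct_of_bijective {R S C : Type*} [CommRing R] [CommRing S]
    [CommRing C] [Algebra R S] [Algebra R C] [Algebra S C] [IsScalarTower R S C]
    (hRS : Function.Bijective (algebraMap R S))
    (h : ∀ (K : Type u) [Field K] [Algebra S K] [FaithfulSMul S K], IsReduced (K ⊗[S] C))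
    (K : Type u) [Field K] [Algebra R K] [FaithfulSMul R K] : IsReduced (K ⊗[R] C) := by
  let e := RingEquiv.ofBijective (algebraMap R S) hRS
  let : Algebra S K := ((algebraMap R K).comp (e.symm : S →+* R)).toAlgebra
  have : IsScalarTower R S K := IsScalarTower.of_algebraMap_eq fun r =>
    congrArg (algebraMap R K) (e.symm_apply_apply r).symm
  have : FaithfulSMul S K := by
    rw [faithfulSMul_iff_algebraMap_injective]
    exact (FaithfulSMul.algebraMap_injective R K).comp e.symm.injective
  have hcomp : TensorProduct.CompatibleSMul R S K C := by
    refine ⟨fun s k c => ?_⟩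
    obtain ⟨r, rfl⟩ := hRS.2 s
    rw [algebraMap_smul, algebraMap_smul, TensorProduct.smul_tmul]
  have := h K
  exact isReduced_of_injective (Algebra.TensorProduct.equivOfCompatibleSMul R S R K C).symm
    (AlgEquiv.injective _)

theorem isReduced_tensorProduct_of_ringEquiv {S C D : Type*} [CommRing S] [CommRing C]
    [CommRing D] [Algebra S C] [Algebra S D] (e : C ≃+* D)
    (he : ∀ s, e (algebraMap S C s) = algebraMap S D s) (K : Type*) [Field K] [Algebra S K]
    [IsReduced (K ⊗[S] C)] : IsReduced (K ⊗[S] D) :=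
  isReduced_of_injective (Algebra.TensorProduct.congr (AlgEquiv.refl : K ≃ₐ[S] K)
    (AlgEquiv.ofRingEquiv (f := e) he)).symm (AlgEquiv.injective _)

/-! ### Excellence of the closure, and the finite case. -/

section Main

variable {R : Type u} [CommRing R] [IsDomain R] [IsDiscreteValuationRing R]

theorem algebraMap_pRadicalClosure_injective :
    Function.Injective (algebraMap R (pRadicalClosure R)) := fun _ _ hab =>
  algebraMap_completion_injective R (congrArg (algebraMap (pRadicalClosure R) (Completion R)) hab)

/-- Nakayama's lemma, applied to the decomposition of each element as `r + ϖ * y`. -/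
theorem algebraMap_pRadicalClosure_surjective_of_finite
    [hfin : Module.Finite R (pRadicalClosure R)] :
    Function.Surjective (algebraMap R (pRadicalClosure R)) := by
  obtain ⟨ϖ, hϖ⟩ := IsDiscreteValuationRing.exists_irreducible R
  have h : (⊤ : Submodule R (pRadicalClosure R)) ≤
      LinearMap.range (Algebra.linearMap R (pRadicalClosure R)) := by
    refine Submodule.le_of_le_smul_of_le_jacobson_bot hfin.fg_top
      (IsLocalRing.maximalIdeal_le_jacobson ⊥) fun x _ => ?_
    obtain ⟨r, y, rfl⟩ := exists_eq_add_mul_pRadicalClosure hϖ x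
    refine Submodule.add_mem_sup ⟨r, rfl⟩ ?_
    rw [← Algebra.smul_def]
    exact Submodule.smul_mem_smul hϖ.not_isUnit trivial
  exact fun x => h (Submodule.mem_top (x := x))

theorem isExcellentLocalRing_pRadicalClosure
    (h : ∀ (K : Type u) [Field K] [Algebra (pRadicalClosure R) K]
      [FaithfulSMul (pRadicalClosure R) K], IsReduced (K ⊗[pRadicalClosure R] Completion R)) :
    IsExcellentLocalRing (pRadicalClosure R) := by
  refine isExcellentLocalRing_of_isReduced (pRadicalClosure R) fun K _ _ _ => ?_
  have := h K
  exact isReduced_tensorProduct_of_ringEquiv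
    (RingEquiv.ofBijective (completionMap R (pRadicalClosure R))
      completionMap_pRadicalClosure_bijective) completionMap_coe_pRadicalClosure K

theorem isExcellentLocalRing_of_finite_pRadicalClosure
    (h : ∀ (K : Type u) [Field K] [Algebra (pRadicalClosure R) K]
      [FaithfulSMul (pRadicalClosure R) K], IsReduced (K ⊗[pRadicalClosure R] Completion R))
    [Module.Finite R (pRadicalClosure R)] : IsExcellentLocalRing R :=
  isExcellentLocalRing_of_isReduced R (isReduced_tensorProduct_of_bijective
    ⟨algebraMap_pRadicalClosure_injective, algebraMap_pRadicalClosure_surjective_of_finite⟩ h)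

end Main

end PRC

end

theorem theorem4p4 (R : Type*) [CommRing R] [IsDomain R] [IsDiscreteValuationRing R]
    (h : ∃ F' : IntermediateField (FractionRing R) (FractionRing (PRC.Completion R)),
      IsPurelyInseparable (FractionRing R) F' ∧
        PRC.IsSeparableExtension F' (FractionRing (PRC.Completion R))) :
    IsDiscreteValuationRing (PRC.pRadicalClosure R) ∧
    PRC.IsExcellentLocalRing (PRC.pRadicalClosure R) ∧
    PRC.ramificationIndex R (PRC.pRadicalClosure R) = 1 ∧
    PRC.residualDegree R (PRC.pRadicalClosure R) = 1 ∧
    PRC.degree R (PRC.pRadicalClosure R) =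
      ⨆ A : {A : Subalgebra R (PRC.pRadicalClosure R) // Module.Finite R A},
        (Module.finrank R A.1 : ℕ∞) ∧
    Function.Bijective (PRC.completionMap R (PRC.pRadicalClosure R)) ∧
    (¬ PRC.IsExcellentLocalRing R →
      Algebra.IsIntegral R (PRC.pRadicalClosure R) ∧
      ¬ Module.Finite R (PRC.pRadicalClosure R)) := by
  obtain ⟨F', hpi, hsep⟩ := h
  have hred := PRC.isReduced_tensorProduct_completion F' hsep
  exact ⟨inferInstance, PRC.isExcellentLocalRing_pRadicalClosure hred,
    PRC.ramificationIndex_pRadicalClosure, PRC.residualDegree_pRadicalClosure,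
    PRC.degree_eq_iSup_finrank R (PRC.pRadicalClosure R),
    PRC.completionMap_pRadicalClosure_bijective, fun hR => ⟨inferInstance, fun _ =>
      hR (PRC.isExcellentLocalRing_of_finite_pRadicalClosure hred)⟩⟩
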